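/- For a finite Blaschke product $\alpha$ let $K_\alpha=H^2\ominus\alpha H^2\subset L^2(\partial\mathbb D)$, let $P_\alpha$ be the orthogonal projection of $L^2(\partial\mathbb D)$ onto $K_\alpha$, and for $w\in\mathbb D$ let $$k_w^\alpha(z)=\frac{1-\overline{\alpha(w)}\alpha(z)}{1-\overline w z},\qquad \widetilde k_w^\alpha=C_\alpha k_w^\alpha,\quad\text{where } C_\alpha f(z)=\alpha(z)\,\overline z\,\overline{f(z)}\ (|z|=1),$$ so that $\widetilde k_w^\alpha(z)=\frac{\alpha(z)-\alpha(w)}{z-w}$. For finite Blaschke products $\alpha,\beta$ let $\mathcal T(\alpha,\beta)$ be the set of all operators $A_\varphi^{\alpha,\beta}:K_\alpha\to K_\beta$, $A_\varphi^{\alpha,\beta}f=P_\beta(\varphi f)$, that are bounded, where $\varphi\in L^2(\partial\mathbb D)$. **Theorem.** Let $m,n\ge 1$, let $a_1,\dots,a_m\in\mathbb D$ be distinct, let $b_1,\dots,b_n\in\mathbb D$ be distinct, and let $$\alpha(z)=\prod_{i=1}^m\frac{a_i-z}{1-\overline{a_i}z},\qquad \beta(z)=\prod_{j=1}^n\frac{b_j-z}{1-\overline{b_j}z}.$$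 Assume that $\alpha$ and $\beta$ have precisely $l$ zeros in common, namely $a_i=b_i$ for $i\le l$ ($l=0$ if there are no zeros in common). Then $\{\widetilde k_{a_1}^\alpha,\dots,\widetilde k_{a_m}^\alpha\}$ is a basis of $K_\alpha$ and $\{\widetilde k_{b_1}^\beta,\dots,\widetilde k_{b_n}^\beta\}$ is a basis of $K_\beta$. Let $A:K_\alpha\to K_\beta$ be any linear transformation and let $(t_{s,p})_{1\le s\le n,\,1\le p\le m}$ be its matrix with respect to these bases, that is, $A\widetilde k_{a_p}^\alpha=\sum_{s=1}^n t_{s,p}\widetilde k_{b_s}^\beta$ for $1\le p\le m$. (a) If $l=0$, then $A\in\mathcal T(\alpha,\beta)$ if and only if $$t_{s,p}=\frac{\beta'(b_s)(a_1-b_s)t_{s,1}+\beta'(b_1)(b_1-a_1)t_{1,1}+\beta'(b_1)(a_p-b_1)t_{1,p}}{\beta'(b_s)(a_p-b_s)}$$ for all $1\le p\le m$ and $1\le s\le n$. (b) If $l>0$, then $A\in\mathcal T(\alpha,\beta)$ if and only if $$t_{s,p}=\frac{\beta'(b_1)(a_1-b_s)t_{1,s}+\beta'(b_1)(a_p-b_1)t_{1,p}}{\beta'(b_s)(a_p-b_s)}$$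 for all $p,s$ with $1\le p\le m$, $1\le s\le l$, $s\ne p$, and $$t_{s,p}=\frac{\beta'(b_s)(a_1-b_s)t_{s,1}+\beta'(b_1)(a_p-b_1)t_{1,p}}{\beta'(b_s)(a_p-b_s)}$$ for all $p,s$ with $1\le p\le m$, $l<s\le n$. -/

import Mathlib

noncomputable section

namespace ATTO

open MeasureTheory AddCircle ComplexConjugate

/-- `L²(∂𝔻)`. The unit circle is parametrized by `t ↦ exp (2πit)`, `t ∈ ℝ/ℤ`, and carries the
normalized Lebesgue measure. -/
abbrev L2 : Type := Lp ℂ 2 (haarAddCircle : Measure UnitAddCircle)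

/-- The point `exp (2πit)` of the unit circle. -/
def pt (t : UnitAddCircle) : ℂ := (toCircle t : ℂ)

/-- The Hardy space `H²`, as a subspace of `L²(∂𝔻)` (via boundary values): the functions whose
Fourier coefficients of negative index vanish. -/
def H2 : Submodule ℂ L2 where
  carrier := {f | ∀ k : ℤ, k < 0 → fourierCoeff f k = 0}
  zero_mem' := by
    intro k _
    rw [← fourierBasis_repr]
    simp
  add_mem' := by
    intro f g hf hg k hk
    have h1 := hf k hk
    have h2 := hg k hk
    rw [← fourierBasis_repr] at h1 h2 ⊢
    simp [h1, h2]
  smul_mem' := by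
    intro c f hf k hk
    have h1 := hf k hk
    rw [← fourierBasis_repr] at h1 ⊢
    simp [h1]

theorem isClosed_H2 : IsClosed (H2 : Set L2) := by
  have h : (H2 : Set L2) =
      ⋂ (k : ℤ) (_ : k < 0), {f : L2 | inner ℂ (fourierBasis (T := 1) k) f = 0} := by
    ext f
    simp only [SetLike.mem_coe, Set.mem_iInter, Set.mem_ofPred_eq,
      ← HilbertBasis.repr_apply_apply, fourierBasis_repr]
    rfl
  rw [h]
  refine isClosed_iInter fun k => isClosed_iInter fun _ => ?_
  exact isClosed_eq (Continuous.inner continuous_const continuous_id) continuous_const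

/-- The subspace `u H²` of `L²(∂𝔻)`, for an inner function `u` (only its values on the unit circle
matter). -/
def mulH2 (u : ℂ → ℂ) : Submodule ℂ L2 where
  carrier := {h | ∃ g ∈ H2, ∀ᵐ t ∂haarAddCircle, h t = u (pt t) * g t}
  zero_mem' := by
    refine ⟨0, H2.zero_mem, ?_⟩
    filter_upwards [Lp.coeFn_zero ℂ 2 (haarAddCircle : Measure UnitAddCircle)] with t _
    simp
  add_mem' := by
    rintro h₁ h₂ ⟨g₁, hg₁, e₁⟩ ⟨g₂, hg₂, e₂⟩
    refine ⟨g₁ + g₂, H2.add_mem hg₁ hg₂, ?_⟩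
    filter_upwards [e₁, e₂, Lp.coeFn_add h₁ h₂, Lp.coeFn_add g₁ g₂] with t a₁ a₂ a₃ a₄
    simp only [a₃, a₄, Pi.add_apply, a₁, a₂]
    ring
  smul_mem' := by
    rintro c h ⟨g, hg, e⟩
    refine ⟨c • g, H2.smul_mem c hg, ?_⟩
    filter_upwards [e, Lp.coeFn_smul c h, Lp.coeFn_smul c g] with t a₁ a₂ a₃
    simp only [a₂, a₃, Pi.smul_apply, smul_eq_mul, a₁]
    ring

/-- The model space `K_u = H² ⊖ u H²`. -/
def modelSpace (u : ℂ → ℂ) : Submodule ℂ L2 := H2 ⊓ (mulH2 u)ᗮ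

instance (u : ℂ → ℂ) : CompleteSpace (modelSpace u) := by
  have h : IsClosed (modelSpace u : Set L2) :=
    isClosed_H2.inter (mulH2 u).isClosed_orthogonal
  exact h.completeSpace_coe

/-- `A ∈ 𝒯(u, v)`: `A` is a bounded operator from `K_u` to `K_v`, and for some symbol
`φ ∈ L²(∂𝔻)` it is the operator `A_φ f = P_v (φ f)`, where `P_v` is the orthogonal projection of
`L²(∂𝔻)` onto `K_v` and `f` runs through the functions of `K_u` with `φ f ∈ L²(∂𝔻)`.
These include all bounded functions in `K_u`, which are dense in `K_u`; when `u` is a finite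
Blaschke product, they are all the functions in `K_u`. -/
def IsATTO (u v : ℂ → ℂ) (A : modelSpace u →ₗ[ℂ] modelSpace v) : Prop :=
  Continuous A ∧ ∃ φ : L2, ∀ (f : modelSpace u)
    (hf : MemLp (fun t => φ t * (f : L2) t) 2 (haarAddCircle : Measure UnitAddCircle)),
    (A f : L2) = (modelSpace v).starProjection (hf.toLp _)

/-- The finite Blaschke product with zeros `a i`. -/
def blaschke {m : ℕ} (a : Fin m → ℂ) (z : ℂ) : ℂ :=
  ∏ i, (a i - z) / (1 - conj (a i) * z)

/-- The reproducing kernel `k_w^u` of `K_u`. -/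
def kernel (u : ℂ → ℂ) (w z : ℂ) : ℂ :=
  (1 - conj (u w) * u z) / (1 - conj w * z)

/-- The conjugation `C_u f (z) = u(z) z̄ f(z)̄`, `|z| = 1`. -/
def conjugation (u f : ℂ → ℂ) (z : ℂ) : ℂ := u z * conj z * conj (f z)

/-- The conjugate kernel `C_u k_w^u` on the unit circle. -/
def conjKernel (u : ℂ → ℂ) (w : ℂ) : ℂ → ℂ := conjugation u (kernel u w)

end ATTO

end

noncomputable section

namespace ATTO

open MeasureTheory AddCircle ComplexConjugate Metric

/-! Since `b s` is a zero of β, the conjugate kernel there is q_s = β/(z - b s), which vanishes at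
the other zeros and takes the value β'(b s) ≠ 0 at `b s`. A function in K_β that vanishes at all
zeros lies in βH² and so is orthogonal to itself. Hence the q_s form a basis, and the coordinates of
f are f(b s)/β'(b s). The Szegő kernels at the zeros lie in K_β, so projecting onto K_β does not
change values at the zeros. For a symbol φ, β'(b s) t_{s,p} is therefore the Cauchy integral at `b
s` of φα/(z - a p). By partial fractions, with Φ the Cauchy integral of αφ, (a p - b s) β'(b s)
t_{s,p} = Φ(a p) - Φ(b s). So the weighted matrix has the form U p - V s, with U and V equal at
common zeros (`isATTO_iff_exists_sub`). Conversely, take a polynomial F with values U and V and with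
derivatives at the common zeros prescribed by the entries that the relation leaves free; the symbol
F times the conjugate of α realizes the matrix. Boundedness is automatic in finite dimension.
Eliminating U and V, which matter only up to a common constant, gives the stated formulas
(`exists_sub_iff_of_ne`, `exists_sub_iff_of_common`). -/

/-! ### Integrals and Fourier coefficients on the circle. -/

theorem norm_pt (t : UnitAddCircle) : ‖pt t‖ = 1 := Circle.norm_coe _

theorem pt_ne_zero (t : UnitAddCircle) : pt t ≠ 0 := Circle.coe_ne_zero _

theorem continuous_pt : Continuous pt := continuous_induced_dom.comp continuous_toCircle

theorem conj_pt (t : UnitAddCircle) : conj (pt t) = (pt t)⁻¹ :=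
  (Circle.coe_inv_eq_conj _).symm.trans (Circle.coe_inv _)

theorem pt_mem_sphere (t : UnitAddCircle) : pt t ∈ sphere (0 : ℂ) 1 := by simp [norm_pt]

theorem sub_ne_zero_of_norm {w z : ℂ} (hw : ‖w‖ < 1) (hz : ‖z‖ = 1) : z - w ≠ 0 := by
  rw [sub_ne_zero]
  rintro rfl
  linarith

theorem pt_sub_ne_zero {w : ℂ} (hw : ‖w‖ < 1) (t : UnitAddCircle) : pt t - w ≠ 0 :=
  sub_ne_zero_of_norm hw (norm_pt t)

theorem one_sub_conj_mul_ne_zero {w z : ℂ} (hw : ‖w‖ < 1) (hz : ‖z‖ ≤ 1) :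
    1 - conj w * z ≠ 0 := by
  rw [sub_ne_zero]
  intro h
  have h1 : ‖conj w * z‖ < 1 := by
    rw [norm_mul, RCLike.norm_conj]
    nlinarith [norm_nonneg w, norm_nonneg z]
  rw [← h] at h1
  simp at h1

theorem fourierCoeff_eq_integral_pt (f : UnitAddCircle → ℂ) (k : ℤ) :
    fourierCoeff f k = ∫ t, pt t ^ (-k) * f t ∂haarAddCircle := by
  simp only [fourierCoeff, fourier_apply, toCircle_zsmul, smul_eq_mul, Circle.coe_zpow, pt]

theorem integral_comp_pt (F : ℂ → ℂ) :
    ∫ t, F (pt t) ∂haarAddCircle = Real.circleAverage F 0 1 := by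
  rw [integral_haarAddCircle, Real.circleAverage, ← AddCircle.intervalIntegral_preimage 1 0]
  have h := intervalIntegral.smul_integral_comp_mul_left (a := 0) (b := 1)
    (fun θ : ℝ => F (circleMap 0 1 θ)) (2 * Real.pi)
  have h2 : ∀ x : ℝ, pt (x : UnitAddCircle) = circleMap 0 1 (2 * Real.pi * x) := by
    intro x
    simp [pt, toCircle_apply_mk, circleMap]
  simp only [zero_add, h2]
  rw [mul_zero, mul_one] at h
  rw [← h, smul_smul, inv_mul_cancel₀ Real.two_pi_pos.ne', inv_one]

theorem integral_cauchy {F : ℂ → ℂ} (hF : DifferentiableOn ℂ F (closedBall 0 1)) {w : ℂ}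
    (hw : ‖w‖ < 1) : ∫ t, pt t / (pt t - w) * F (pt t) ∂haarAddCircle = F w := by
  rw [integral_comp_pt (fun z => z / (z - w) * F z)]
  have hF' : DiffContOnCl ℂ F (ball 0 |1|) := by
    rw [abs_one]
    refine DifferentiableOn.diffContOnCl ?_
    rwa [closure_ball _ one_ne_zero]
  have := hF'.circleAverage_smul_div (w := w) (by simpa using hw)
  simpa using this

theorem memLp_mul_comp_pt {g : ℂ → ℂ} (hg : ContinuousOn g (sphere 0 1)) {f : UnitAddCircle → ℂ}
    (hf : MemLp f 2 (haarAddCircle : Measure UnitAddCircle)) :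
    MemLp (fun t => g (pt t) * f t) 2 (haarAddCircle : Measure UnitAddCircle) := by
  have hc : Continuous fun t => g (pt t) := hg.comp_continuous continuous_pt pt_mem_sphere
  obtain ⟨C, hC⟩ := (isCompact_sphere (0 : ℂ) 1).exists_bound_of_continuousOn hg
  refine hf.of_le_mul (c := C) (hc.aestronglyMeasurable.mul hf.1) (.of_forall fun t => ?_)
  rw [norm_mul]
  exact mul_le_mul_of_nonneg_right (hC _ (pt_mem_sphere t)) (norm_nonneg _)

theorem memLp_comp_pt {g : ℂ → ℂ} (hg : ContinuousOn g (sphere 0 1)) :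
    MemLp (fun t => g (pt t)) 2 (haarAddCircle : Measure UnitAddCircle) := by
  simpa using memLp_mul_comp_pt hg (memLp_const (1 : ℂ))

theorem integrable_mul_comp_pt {g : ℂ → ℂ} (hg : ContinuousOn g (sphere 0 1))
    {f : UnitAddCircle → ℂ} (hf : MemLp f 2 (haarAddCircle : Measure UnitAddCircle)) :
    Integrable (fun t => g (pt t) * f t) (haarAddCircle : Measure UnitAddCircle) :=
  (memLp_mul_comp_pt hg hf).integrable one_le_two

theorem integrable_zpow_mul {f : UnitAddCircle → ℂ}
    (hf : MemLp f 2 (haarAddCircle : Measure UnitAddCircle)) (k : ℤ) :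
    Integrable (fun t => pt t ^ k * f t) (haarAddCircle : Measure UnitAddCircle) :=
  integrable_mul_comp_pt (g := fun z => z ^ k)
    (fun z hz => (continuousAt_zpow₀ z k (.inl (by
      rintro rfl; simp at hz))).continuousWithinAt) hf

theorem fourierCoeff_affine_mul {f : UnitAddCircle → ℂ}
    (hf : MemLp f 2 (haarAddCircle : Measure UnitAddCircle)) (c d : ℂ) (k : ℤ) :
    fourierCoeff (fun t => (c + d * pt t) * f t) k =
      c * fourierCoeff f k + d * fourierCoeff f (k - 1) := by
  simp only [fourierCoeff_eq_integral_pt]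
  rw [← integral_const_mul, ← integral_const_mul, ← integral_add
    ((integrable_zpow_mul hf _).const_mul c) ((integrable_zpow_mul hf _).const_mul d)]
  refine integral_congr_ae (.of_forall fun t => ?_)
  have h : pt t ^ (-(k - 1)) = pt t ^ (-k) * pt t := by
    rw [← zpow_add_one₀ (pt_ne_zero t)]
    congr 1
    ring
  simp only [h]
  ring

theorem norm_fourierCoeff_le (f : UnitAddCircle → ℂ) (k : ℤ) :
    ‖fourierCoeff f k‖ ≤ ∫ t, ‖f t‖ ∂haarAddCircle := by
  rw [fourierCoeff_eq_integral_pt]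
  refine (norm_integral_le_integral_norm _).trans_eq ?_
  simp [norm_pt]

/-! ### Hardy functions: multiplication and division by linear factors. -/

/-- `f` is a representative of an element of the Hardy space `H²`. -/
structure IsHardy (f : UnitAddCircle → ℂ) : Prop where
  memLp : MemLp f 2 (haarAddCircle : Measure UnitAddCircle)
  coeff : ∀ k : ℤ, k < 0 → fourierCoeff f k = 0

theorem isHardy_of_mem {f : L2} (hf : f ∈ H2) : IsHardy f := ⟨Lp.memLp f, hf⟩

theorem IsHardy.congr {f g : UnitAddCircle → ℂ} (hf : IsHardy f)
    (h : ∀ᵐ t ∂haarAddCircle, f t = g t) : IsHardy g :=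
  ⟨hf.memLp.ae_eq h, fun k hk => by rw [← fourierCoeff_congr_ae h]; exact hf.coeff k hk⟩

theorem IsHardy.toLp_mem {f : UnitAddCircle → ℂ} (hf : IsHardy f) : hf.memLp.toLp f ∈ H2 :=
  (hf.congr hf.memLp.coeFn_toLp.symm).coeff

theorem isHardy_comp_pt {F : ℂ → ℂ} (hF : DifferentiableOn ℂ F (closedBall 0 1)) :
    IsHardy fun t => F (pt t) := by
  refine ⟨memLp_comp_pt (hF.continuousOn.mono sphere_subset_closedBall), fun k hk => ?_⟩
  obtain ⟨j, rfl⟩ : ∃ j : ℕ, k = -(j + 1 : ℕ) := ⟨(-k - 1).toNat, by omega⟩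
  rw [fourierCoeff_eq_integral_pt]
  -- The coefficient of index -(j + 1) is the value at 0 of z^(j+1) F.
  have := integral_cauchy (F := fun z => z ^ (j + 1) * F z) (w := 0)
    ((differentiable_id.pow _).differentiableOn.mul hF) (by simp)
  simp only [ne_eq, Nat.add_eq_zero_iff, one_ne_zero, and_false, not_false_eq_true, zero_pow,
    zero_mul, sub_zero] at this
  rw [← this]
  refine integral_congr_ae (.of_forall fun t => ?_)
  simp only [div_self (pt_ne_zero t), one_mul, neg_neg, zpow_natCast]

theorem IsHardy.affine_mul {f : UnitAddCircle → ℂ} (hf : IsHardy f) (c d : ℂ) :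
    IsHardy fun t => (c + d * pt t) * f t :=
  ⟨memLp_mul_comp_pt (g := fun z => c + d * z) (by fun_prop) hf.memLp, fun k hk => by
    rw [fourierCoeff_affine_mul hf.memLp, hf.coeff k hk, hf.coeff (k - 1) (by omega)]
    simp⟩

theorem IsHardy.const_mul {f : UnitAddCircle → ℂ} (hf : IsHardy f) (c : ℂ) :
    IsHardy fun t => c * f t := by
  simpa using hf.affine_mul c 0

theorem IsHardy.sum {ι : Type*} {s : Finset ι} {f : ι → UnitAddCircle → ℂ}
    (hf : ∀ i ∈ s, IsHardy (f i)) : IsHardy fun t => ∑ i ∈ s, f i t := by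
  refine ⟨memLp_finsetSum _ fun i hi => (hf i hi).memLp, fun k hk => ?_⟩
  simp only [fourierCoeff_eq_integral_pt, Finset.mul_sum]
  rw [integral_finsetSum _ fun i hi => integrable_zpow_mul (hf i hi).memLp _]
  refine Finset.sum_eq_zero fun i hi => ?_
  rw [← fourierCoeff_eq_integral_pt]
  exact (hf i hi).coeff k hk

theorem IsHardy.integral_pt_mul {f : UnitAddCircle → ℂ} (hf : IsHardy f) :
    ∫ t, pt t * f t ∂haarAddCircle = 0 := by
  simpa [fourierCoeff_eq_integral_pt] using hf.coeff (-1) (by norm_num)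

/-- Comparing coefficients in (1 - w̄z)h = f makes the negative coefficients of h a geometric
recursion of ratio w̄. They are bounded and |w| < 1, so iterating towards -∞ forces them to vanish.
-/
theorem IsHardy.div_one_sub {f : UnitAddCircle → ℂ} (hf : IsHardy f) {w : ℂ} (hw : ‖w‖ < 1) :
    IsHardy fun t => (1 - conj w * pt t)⁻¹ * f t := by
  have hne : ∀ t, 1 - conj w * pt t ≠ 0 := fun t => one_sub_conj_mul_ne_zero hw (norm_pt t).le
  have hh : MemLp (fun t => (1 - conj w * pt t)⁻¹ * f t) 2
      (haarAddCircle : Measure UnitAddCircle) :=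
    memLp_mul_comp_pt (g := fun z => (1 - conj w * z)⁻¹)
      ((by fun_prop : ContinuousOn _ _).inv₀ fun z hz =>
        one_sub_conj_mul_ne_zero hw (by simpa using (mem_sphere_zero_iff_norm.1 hz).le)) hf.memLp
  refine ⟨hh, fun k hk => ?_⟩
  set h := fun t => (1 - conj w * pt t)⁻¹ * f t with h_def
  have hrec : ∀ k : ℤ, k < 0 → fourierCoeff h k = conj w * fourierCoeff h (k - 1) := by
    intro k hk
    have h1 := fourierCoeff_affine_mul hh 1 (-conj w) k
    have h2 : (fun t => (1 + -conj w * pt t) * h t) = f := by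
      ext t
      have h3 : 1 + -conj w * pt t = 1 - conj w * pt t := by ring
      rw [h_def, h3, mul_inv_cancel_left₀ (hne t)]
    rw [h2, hf.coeff k hk] at h1
    linear_combination -h1
  have hpow : ∀ j : ℕ, fourierCoeff h k = conj w ^ j * fourierCoeff h (k - j) := by
    intro j
    induction j with
    | zero => simp
    | succ j ih =>
      rw [ih, hrec _ (by omega), pow_succ]
      push_cast
      rw [sub_sub]
      ring
  have hlim : Filter.Tendsto (fun j : ℕ => ‖w‖ ^ j * ∫ t, ‖h t‖ ∂haarAddCircle) Filter.atTop
      (nhds 0) := by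
    simpa using (tendsto_pow_atTop_nhds_zero_of_lt_one (norm_nonneg w) hw).mul_const
      (∫ t, ‖h t‖ ∂haarAddCircle)
  have hle : ‖fourierCoeff h k‖ ≤ 0 := by
    refine ge_of_tendsto' hlim fun j => ?_
    rw [hpow j, norm_mul, norm_pow, RCLike.norm_conj]
    exact mul_le_mul_of_nonneg_left (norm_fourierCoeff_le _ _) (by positivity)
  simpa using hle

theorem continuousOn_inv_sub {w : ℂ} (hw : ‖w‖ < 1) :
    ContinuousOn (fun z => (z - w)⁻¹) (sphere 0 1) :=
  (by fun_prop : ContinuousOn _ _).inv₀ fun z hz =>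
    sub_ne_zero_of_norm hw (mem_sphere_zero_iff_norm.1 hz)

/-- The hypothesis says that the coefficient of index -1 of the quotient is 0; the recursion from (z
- w)h = f carries this to all lower indices. -/
theorem IsHardy.inv_sub_mul {f : UnitAddCircle → ℂ} (hf : IsHardy f) {w : ℂ} (hw : ‖w‖ < 1)
    (h0 : ∫ t, pt t / (pt t - w) * f t ∂haarAddCircle = 0) :
    IsHardy fun t => (pt t - w)⁻¹ * f t := by
  have hh : MemLp (fun t => (pt t - w)⁻¹ * f t) 2 (haarAddCircle : Measure UnitAddCircle) :=
    memLp_mul_comp_pt (g := fun z => (z - w)⁻¹) (continuousOn_inv_sub hw) hf.memLp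
  refine ⟨hh, ?_⟩
  set h := fun t => (pt t - w)⁻¹ * f t with h_def
  have hrec : ∀ k : ℤ, k < 0 → fourierCoeff h (k - 1) = w * fourierCoeff h k := by
    intro k hk
    have h1 := fourierCoeff_affine_mul hh (-w) 1 k
    have h2 : (fun t => (-w + 1 * pt t) * h t) = f := by
      ext t
      have h3 : -w + 1 * pt t = pt t - w := by ring
      rw [h_def, h3, mul_inv_cancel_left₀ (pt_sub_ne_zero hw t)]
    rw [h2, hf.coeff k hk] at h1
    linear_combination -h1
  have hneg : ∀ j : ℕ, fourierCoeff h (-1 - j) = 0 := by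
    intro j
    induction j with
    | zero =>
      rw [fourierCoeff_eq_integral_pt, ← h0]
      refine integral_congr_ae (.of_forall fun t => ?_)
      simp only [h_def, div_eq_mul_inv]
      simp [mul_assoc]
    | succ j ih =>
      have := hrec (-1 - j) (by omega)
      rw [ih, mul_zero] at this
      push_cast
      rwa [← sub_sub]
  intro k hk
  have := hneg (-1 - k).toNat
  rwa [show -1 - (((-1 - k).toNat : ℕ) : ℤ) = k by omega] at this

/-! ### Blaschke products and their quotients by a linear factor. -/

/-- The quotient `β(z) / (z - b s)`, where `β` is the Blaschke product with zeros `b`. -/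
def quot {n : ℕ} (b : Fin n → ℂ) (s : Fin n) (z : ℂ) : ℂ :=
  (∏ j ∈ Finset.univ.erase s, (b j - z) / (1 - conj (b j) * z)) * -(1 - conj (b s) * z)⁻¹

theorem one_sub_mul_inv_pt_ne_zero {w : ℂ} (hw : ‖w‖ < 1) (t : UnitAddCircle) :
    1 - w * (pt t)⁻¹ ≠ 0 := by
  have h : 1 - w * (pt t)⁻¹ = (pt t)⁻¹ * (pt t - w) := by
    rw [mul_sub, inv_mul_cancel₀ (pt_ne_zero t), mul_comm w]
  rw [h]
  exact mul_ne_zero (inv_ne_zero (pt_ne_zero t)) (pt_sub_ne_zero hw t)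

section Blaschke

variable {n : ℕ} {b : Fin n → ℂ}

theorem blaschke_eq_sub_mul_quot (b : Fin n → ℂ) (s : Fin n) (z : ℂ) :
    blaschke b z = (z - b s) * quot b s z := by
  rw [blaschke, quot, ← Finset.mul_prod_erase _ _ (Finset.mem_univ s)]
  ring

theorem blaschke_zero (b : Fin n → ℂ) (s : Fin n) : blaschke b (b s) = 0 := by
  rw [blaschke_eq_sub_mul_quot b s, sub_self, zero_mul]

/-- The product form of `quot` involves no division by z - b s, so `b s` is not exceptional. -/
theorem differentiableOn_quot (hb : ∀ j, ‖b j‖ < 1) (s : Fin n) :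
    DifferentiableOn ℂ (quot b s) (closedBall 0 1) := by
  have hne : ∀ j, ∀ z ∈ closedBall (0 : ℂ) 1, 1 - conj (b j) * z ≠ 0 := fun j z hz =>
    one_sub_conj_mul_ne_zero (hb j) (by simpa using hz)
  unfold quot
  refine DifferentiableOn.mul (DifferentiableOn.fun_finsetProd fun j _ => ?_) ?_
  · exact DifferentiableOn.div (by fun_prop) (by fun_prop) (hne j)
  · exact (DifferentiableOn.inv (by fun_prop) (hne s)).neg

theorem deriv_blaschke (hb : ∀ j, ‖b j‖ < 1) (s : Fin n) :
    deriv (blaschke b) (b s) = quot b s (b s) := by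
  have hq : DifferentiableAt ℂ (quot b s) (b s) :=
    (differentiableOn_quot hb s).differentiableAt
      (Filter.mem_of_superset (isOpen_ball.mem_nhds (by simpa using hb s)) ball_subset_closedBall)
  have h := (((hasDerivAt_id (b s)).sub_const (b s)).mul hq.hasDerivAt).deriv
  simp only [id, sub_self, zero_mul, add_zero, one_mul] at h
  rw [← h]
  congr 1
  ext z
  rw [blaschke_eq_sub_mul_quot b s]
  rfl

theorem quot_of_ne {r s : Fin n} (h : r ≠ s) : quot b s (b r) = 0 := by
  rw [quot, Finset.prod_eq_zero (Finset.mem_erase.2 ⟨h, Finset.mem_univ r⟩) (by simp), zero_mul]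

theorem quot_self_ne_zero (hb : ∀ j, ‖b j‖ < 1) (hinj : Function.Injective b) (s : Fin n) :
    quot b s (b s) ≠ 0 := by
  have hne : ∀ j, 1 - conj (b j) * b s ≠ 0 := fun j =>
    one_sub_conj_mul_ne_zero (hb j) (hb s).le
  refine mul_ne_zero (Finset.prod_ne_zero_iff.2 fun j hj => div_ne_zero ?_ (hne j))
    (neg_ne_zero.2 (inv_ne_zero (hne s)))
  exact sub_ne_zero.2 (hinj.ne (Finset.ne_of_mem_erase hj))

theorem conj_blaschke_mul_blaschke (hb : ∀ j, ‖b j‖ < 1) (t : UnitAddCircle) :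
    conj (blaschke b (pt t)) * blaschke b (pt t) = 1 := by
  rw [blaschke, map_prod, ← Finset.prod_mul_distrib]
  refine Finset.prod_eq_one fun j _ => ?_
  have h1 := one_sub_conj_mul_ne_zero (hb j) (norm_pt t).le
  have h2 := pt_sub_ne_zero (hb j) t
  have h3 := pt_ne_zero t
  have h4 := one_sub_mul_inv_pt_ne_zero (hb j) t
  simp only [map_div₀, map_sub, map_mul, map_one, conj_pt, Complex.conj_conj]
  field_simp
  ring

theorem conjKernel_blaschke (hb : ∀ j, ‖b j‖ < 1) (s : Fin n) (t : UnitAddCircle) :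
    conjKernel (blaschke b) (b s) (pt t) = quot b s (pt t) := by
  have h2 := pt_sub_ne_zero (hb s) t
  have h3 := pt_ne_zero t
  have h4 := one_sub_mul_inv_pt_ne_zero (hb s) t
  rw [conjKernel, conjugation, kernel, blaschke_zero, blaschke_eq_sub_mul_quot b s]
  simp only [map_div₀, map_sub, map_mul, map_one, map_zero, conj_pt, Complex.conj_conj]
  field_simp
  ring

theorem IsHardy.quot_mul {f : UnitAddCircle → ℂ} (hf : IsHardy f) (hb : ∀ j, ‖b j‖ < 1)
    (s : Fin n) : IsHardy fun t => quot b s (pt t) * f t := by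
  have key : ∀ S : Finset (Fin n),
      IsHardy fun t => (∏ j ∈ S, (b j - pt t) / (1 - conj (b j) * pt t)) * f t := by
    intro S
    induction S using Finset.induction_on with
    | empty => simpa using hf
    | insert j S hj ih =>
      refine ((ih.affine_mul (b j) (-1)).div_one_sub (hb j)).congr (.of_forall fun t => ?_)
      rw [Finset.prod_insert hj]
      ring
  refine (((key (Finset.univ.erase s)).div_one_sub (hb s)).const_mul (-1)).congr
    (.of_forall fun t => ?_)
  rw [quot]
  ring

end Blaschke

/-! ### The model space, evaluation at the zeros, and the basis. -/

theorem inner_toLp_left {f : UnitAddCircle → ℂ}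
    (hf : MemLp f 2 (haarAddCircle : Measure UnitAddCircle)) (g : L2) :
    inner ℂ (hf.toLp f) g = ∫ t, conj (f t) * g t ∂haarAddCircle := by
  rw [L2.inner_def]
  refine integral_congr_ae ?_
  filter_upwards [hf.coeFn_toLp] with t ht
  rw [ht, RCLike.inner_apply, mul_comm]

theorem toLp_mem_modelSpace {u : ℂ → ℂ} {f : UnitAddCircle → ℂ} (hf : IsHardy f)
    (h : ∀ g, IsHardy g → ∫ t, conj (f t) * (u (pt t) * g t) ∂haarAddCircle = 0) :
    hf.memLp.toLp f ∈ modelSpace u := by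
  refine ⟨hf.toLp_mem, (Submodule.mem_orthogonal' _ _).2 ?_⟩
  rintro k ⟨g, hg, hk⟩
  rw [inner_toLp_left, ← h g (isHardy_of_mem hg)]
  refine integral_congr_ae ?_
  filter_upwards [hk] with t ht
  rw [ht]

theorem isHardy_szego {w : ℂ} (hw : ‖w‖ < 1) :
    IsHardy fun t => (1 - conj w * pt t)⁻¹ :=
  isHardy_comp_pt (F := fun z => (1 - conj w * z)⁻¹)
    (DifferentiableOn.inv (by fun_prop) fun z hz =>
      one_sub_conj_mul_ne_zero hw (by simpa using hz))

theorem conj_szego {w : ℂ} (hw : ‖w‖ < 1) (t : UnitAddCircle) :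
    conj (1 - conj w * pt t)⁻¹ = pt t / (pt t - w) := by
  have h2 := pt_sub_ne_zero hw t
  have h3 := pt_ne_zero t
  simp only [map_inv₀, map_sub, map_mul, map_one, conj_pt, Complex.conj_conj]
  rw [eq_div_iff h2, inv_mul_eq_iff_eq_mul₀ (one_sub_mul_inv_pt_ne_zero hw t)]
  field_simp

/-- Evaluation at `w ∈ 𝔻` of functions in `H²`, written as a Cauchy integral. -/
def cauchy (w : ℂ) (f : UnitAddCircle → ℂ) : ℂ :=
  ∫ t, pt t / (pt t - w) * f t ∂haarAddCircle

theorem inner_szego {w : ℂ} (hw : ‖w‖ < 1) (f : L2) :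
    inner ℂ ((isHardy_szego hw).memLp.toLp _) f = cauchy w f := by
  rw [inner_toLp_left, cauchy]
  simp only [conj_szego hw]

section ModelSpace

variable {n : ℕ} {b : Fin n → ℂ}

theorem szego_mem_modelSpace (hb : ∀ j, ‖b j‖ < 1) (s : Fin n) :
    (isHardy_szego (hb s)).memLp.toLp _ ∈ modelSpace (blaschke b) := by
  refine toLp_mem_modelSpace (isHardy_szego (hb s)) fun g hg => ?_
  rw [← (hg.quot_mul hb s).integral_pt_mul]
  refine integral_congr_ae (.of_forall fun t => ?_)
  have h2 := pt_sub_ne_zero (hb s) t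
  simp only [conj_szego (hb s), blaschke_eq_sub_mul_quot b s]
  field_simp

theorem isHardy_quot (hb : ∀ j, ‖b j‖ < 1) (s : Fin n) : IsHardy fun t => quot b s (pt t) :=
  isHardy_comp_pt (differentiableOn_quot hb s)

theorem quot_mem_modelSpace (hb : ∀ j, ‖b j‖ < 1) (s : Fin n) :
    (isHardy_quot hb s).memLp.toLp _ ∈ modelSpace (blaschke b) := by
  refine toLp_mem_modelSpace (isHardy_quot hb s) fun g hg => ?_
  rw [← (hg.div_one_sub (hb s)).integral_pt_mul]
  refine integral_congr_ae (.of_forall fun t => ?_)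
  have h2 := pt_sub_ne_zero (hb s) t
  have h1 := one_sub_conj_mul_ne_zero (hb s) (norm_pt t).le
  have h5 := conj_blaschke_mul_blaschke hb t
  have h6 : conj (pt t - b s) * pt t = 1 - conj (b s) * pt t := by
    rw [map_sub, conj_pt, sub_mul, inv_mul_cancel₀ (pt_ne_zero t)]
  nth_rewrite 1 [blaschke_eq_sub_mul_quot b s] at h5
  rw [map_mul] at h5
  -- Unimodularity of β turns the integrand into z times a Hardy function, whose mean is 0.
  have h7 : conj (quot b s (pt t)) * blaschke b (pt t) = pt t * (1 - conj (b s) * pt t)⁻¹ := by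
    rw [eq_mul_inv_iff_mul_eq₀ h1, ← h6]
    linear_combination pt t * h5
  beta_reduce
  rw [← mul_assoc, h7, mul_assoc]

/-- The conjugate kernel at the zero `b s`, as an element of the model space. -/
def quotL2 (hb : ∀ j, ‖b j‖ < 1) (s : Fin n) : modelSpace (blaschke b) :=
  ⟨_, quot_mem_modelSpace hb s⟩

theorem coeFn_quotL2 (hb : ∀ j, ‖b j‖ < 1) (s : Fin n) :
    ∀ᵐ t ∂haarAddCircle, (quotL2 hb s : L2) t = quot b s (pt t) :=
  (isHardy_quot hb s).memLp.coeFn_toLp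

/-- Evaluation at the zeros of a Blaschke product, on its model space. -/
def evalZeros (hb : ∀ j, ‖b j‖ < 1) : modelSpace (blaschke b) →ₗ[ℂ] Fin n → ℂ :=
  LinearMap.pi fun s =>
    (innerSL ℂ ((isHardy_szego (hb s)).memLp.toLp _)).toLinearMap ∘ₗ (modelSpace _).subtype

theorem evalZeros_apply (hb : ∀ j, ‖b j‖ < 1) (f : modelSpace (blaschke b)) (s : Fin n) :
    evalZeros hb f s = cauchy (b s) (f : L2) :=
  inner_szego (hb s) _

/-- Evaluation at `b s` is the inner product with a Szegő kernel that the projection fixes. -/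
theorem cauchy_starProjection (hb : ∀ j, ‖b j‖ < 1) (s : Fin n) (g : L2) :
    cauchy (b s) ((modelSpace (blaschke b)).starProjection g) = cauchy (b s) g := by
  rw [← inner_szego (hb s), ← inner_szego (hb s), ← Submodule.inner_starProjection_left_eq_right,
    Submodule.starProjection_eq_self_iff.2 (szego_mem_modelSpace hb s)]

theorem evalZeros_quotL2 (hb : ∀ j, ‖b j‖ < 1) (s : Fin n) :
    evalZeros hb (quotL2 hb s) = Pi.single s (quot b s (b s)) := by
  ext r
  have h : cauchy (b r) (quotL2 hb s : L2) = quot b s (b r) := by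
    rw [cauchy, ← integral_cauchy (differentiableOn_quot hb s) (hb r)]
    refine integral_congr_ae ?_
    filter_upwards [coeFn_quotL2 hb s] with t ht
    rw [ht]
  rw [evalZeros_apply, h]
  by_cases hr : r = s
  · subst hr
    simp
  · rw [Pi.single_eq_of_ne hr, quot_of_ne hr]

/-- As the zeros are distinct, 1/∏(z - b s) is a linear combination of the 1/(z - b s), so f need
only be divided by one factor at a time. Multiplying by the denominators of β then gives f/β. -/
theorem mem_mulH2_of_cauchy_eq_zero (hb : ∀ j, ‖b j‖ < 1) (hinj : Function.Injective b) [NeZero n]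
    {f : L2} (hf : f ∈ H2) (h0 : ∀ s, cauchy (b s) f = 0) : f ∈ mulH2 (blaschke b) := by
  have h1 : IsHardy fun t => ∑ s, Lagrange.nodalWeight Finset.univ b s *
      ((pt t - b s)⁻¹ * f t) :=
    IsHardy.sum fun s _ => ((isHardy_of_mem hf).inv_sub_mul (hb s) (h0 s)).const_mul _
  have h2 : IsHardy fun t => (∏ s, (b s - pt t))⁻¹ * f t := by
    refine (h1.const_mul ((-1) ^ n)).congr (.of_forall fun t => ?_)
    -- Interpolating the constant 1 yields the partial fraction expansion.
    have h3 := Lagrange.eval_interpolate_not_at_node (s := Finset.univ) (v := b) (x := pt t)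
      (1 : Fin n → ℂ) fun i _ => sub_ne_zero.1 (pt_sub_ne_zero (hb i) t)
    rw [Lagrange.interpolate_one hinj.injOn Finset.univ_nonempty, Polynomial.eval_one,
      Lagrange.eval_nodal] at h3
    simp only [Pi.one_apply, mul_one] at h3
    have h4 : ∏ s, (b s - pt t) = (-1) ^ n * ∏ s, (pt t - b s) := by
      simp only [← neg_sub (pt t), Finset.prod_neg, Finset.card_univ, Fintype.card_fin]
    have h5 : ∏ s, (pt t - b s) ≠ 0 :=
      Finset.prod_ne_zero_iff.2 fun s _ => pt_sub_ne_zero (hb s) t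
    simp only [← mul_assoc, ← Finset.sum_mul]
    rw [h4, eq_inv_of_mul_eq_one_right h3.symm, mul_inv, ← inv_pow, inv_neg_one]
  have h3 : ∀ S : Finset (Fin n), IsHardy fun t =>
      (∏ s ∈ S, (1 - conj (b s) * pt t)) * ((∏ s, (b s - pt t))⁻¹ * f t) := by
    intro S
    induction S using Finset.induction_on with
    | empty => simpa using h2
    | insert j S hj ih =>
      refine (ih.affine_mul 1 (-conj (b j))).congr (.of_forall fun t => ?_)
      rw [Finset.prod_insert hj]
      ring
  refine ⟨_, (h3 Finset.univ).toLp_mem, ?_⟩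
  filter_upwards [(h3 Finset.univ).memLp.coeFn_toLp] with t ht
  have h5 : ∏ s, (b s - pt t) ≠ 0 :=
    Finset.prod_ne_zero_iff.2 fun s _ => by
      rw [← neg_sub]
      exact neg_ne_zero.2 (pt_sub_ne_zero (hb s) t)
  have h6 : ∏ s, (1 - conj (b s) * pt t) ≠ 0 :=
    Finset.prod_ne_zero_iff.2 fun s _ => one_sub_conj_mul_ne_zero (hb s) (norm_pt t).le
  rw [ht, blaschke, Finset.prod_div_distrib, ← mul_assoc, ← mul_assoc, div_mul_cancel₀ _ h6,
    mul_inv_cancel₀ h5, one_mul]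

theorem evalZeros_injective (hb : ∀ j, ‖b j‖ < 1) (hinj : Function.Injective b) [NeZero n] :
    Function.Injective (evalZeros hb) := by
  rw [injective_iff_map_eq_zero]
  rintro ⟨f, hf, hf'⟩ h
  have h1 := mem_mulH2_of_cauchy_eq_zero hb hinj hf fun s => by
    rw [← evalZeros_apply hb ⟨f, hf, hf'⟩, h, Pi.zero_apply]
  have h2 := (Submodule.mem_orthogonal _ _).1 hf' f h1
  rw [inner_self_eq_zero] at h2
  exact Subtype.ext h2

/-- Rescaled by 1/β'(b s), evaluation at the zeros becomes the coordinate map of the conjugate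
kernels. -/
theorem bijective_smul_evalZeros (hb : ∀ j, ‖b j‖ < 1) (hinj : Function.Injective b) [NeZero n] :
    Function.Bijective
      ((LinearMap.pi fun s => (quot b s (b s))⁻¹ • LinearMap.proj s) ∘ₗ evalZeros hb :
        modelSpace (blaschke b) →ₗ[ℂ] Fin n → ℂ) := by
  have hq := quot_self_ne_zero hb hinj
  refine ⟨?_, fun c => ⟨∑ s, c s • quotL2 hb s, ?_⟩⟩
  · rw [injective_iff_map_eq_zero]
    intro f hf
    refine (injective_iff_map_eq_zero _).1 (evalZeros_injective hb hinj) f ?_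
    ext s
    simpa [hq s] using congrFun hf s
  · ext r
    simp [evalZeros_quotL2, Pi.single_apply, hq r]

/-- The basis of the model space formed by the conjugate kernels at the zeros. -/
def conjKernelBasis (hb : ∀ j, ‖b j‖ < 1) (hinj : Function.Injective b) [NeZero n] :
    Module.Basis (Fin n) ℂ (modelSpace (blaschke b)) :=
  .ofEquivFun (LinearEquiv.ofBijective _ (bijective_smul_evalZeros hb hinj))

theorem conjKernelBasis_repr (hb : ∀ j, ‖b j‖ < 1) (hinj : Function.Injective b) [NeZero n]
    (f : modelSpace (blaschke b)) (s : Fin n) :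
    quot b s (b s) * (conjKernelBasis hb hinj).repr f s = cauchy (b s) (f : L2) := by
  rw [← evalZeros_apply hb, conjKernelBasis, Module.Basis.ofEquivFun_repr_apply]
  simp [quot_self_ne_zero hb hinj s]

theorem conjKernelBasis_apply (hb : ∀ j, ‖b j‖ < 1) (hinj : Function.Injective b) [NeZero n]
    (s : Fin n) : conjKernelBasis hb hinj s = quotL2 hb s := by
  rw [← (conjKernelBasis hb hinj).repr.injective.eq_iff, Module.Basis.repr_self]
  ext r
  refine mul_left_cancel₀ (quot_self_ne_zero hb hinj r) ?_
  rw [conjKernelBasis_repr, ← evalZeros_apply hb, evalZeros_quotL2]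
  by_cases hr : r = s
  · subst hr
    simp
  · simp [hr]

end ModelSpace

/-! ### Cauchy integrals of symbols, and Hermite interpolation. -/

theorem continuousOn_cauchyKernel {w : ℂ} (hw : ‖w‖ < 1) :
    ContinuousOn (fun z => z / (z - w)) (sphere 0 1) :=
  ContinuousOn.div (by fun_prop) (by fun_prop) fun z hz =>
    sub_ne_zero_of_norm hw (mem_sphere_zero_iff_norm.1 hz)

theorem integrable_cauchy {w : ℂ} (hw : ‖w‖ < 1) {f : UnitAddCircle → ℂ}
    (hf : MemLp f 2 (haarAddCircle : Measure UnitAddCircle)) :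
    Integrable (fun t => pt t / (pt t - w) * f t) (haarAddCircle : Measure UnitAddCircle) :=
  integrable_mul_comp_pt (continuousOn_cauchyKernel hw) hf

theorem cauchy_congr {w : ℂ} {f g : UnitAddCircle → ℂ} (h : ∀ᵐ t ∂haarAddCircle, f t = g t) :
    cauchy w f = cauchy w g := by
  refine integral_congr_ae ?_
  filter_upwards [h] with t ht
  rw [ht]

theorem cauchy_sum_mul {ι : Type*} (s : Finset ι) {w : ℂ} (hw : ‖w‖ < 1) (c : ι → ℂ)
    {f : ι → UnitAddCircle → ℂ}
    (hf : ∀ i, MemLp (f i) 2 (haarAddCircle : Measure UnitAddCircle)) :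
    cauchy w (fun t => ∑ i ∈ s, c i * f i t) = ∑ i ∈ s, c i * cauchy w (f i) := by
  simp only [cauchy, Finset.mul_sum, ← integral_const_mul]
  rw [← integral_finsetSum _ fun i _ => (integrable_cauchy hw (hf i)).const_mul (c i)]
  refine integral_congr_ae (.of_forall fun t => Finset.sum_congr rfl fun i _ => ?_)
  ring

/-- Partial fractions of z/((z - a p)(z - w)); this is the source of the form U p - V s. -/
theorem cauchy_quot_eq_sub {m : ℕ} {a : Fin m → ℂ} (ha : ∀ i, ‖a i‖ < 1) {w : ℂ} (hw : ‖w‖ < 1)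
    (φ : L2) (p : Fin m) :
    (a p - w) * cauchy w (fun t => quot a p (pt t) * φ t) =
      cauchy (a p) (fun t => blaschke a (pt t) * φ t) -
        cauchy w (fun t => blaschke a (pt t) * φ t) := by
  have h : MemLp (fun t => blaschke a (pt t) * φ t) 2
      (haarAddCircle : Measure UnitAddCircle) := by
    simp only [blaschke_eq_sub_mul_quot a p]
    exact memLp_mul_comp_pt (g := fun z => (z - a p) * quot a p z)
      ((by fun_prop : ContinuousOn _ _).mul
        ((differentiableOn_quot ha p).continuousOn.mono sphere_subset_closedBall)) (Lp.memLp φ)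
  simp only [cauchy]
  rw [← integral_sub (integrable_cauchy (ha p) h) (integrable_cauchy hw h), ← integral_const_mul]
  refine integral_congr_ae (.of_forall fun t => ?_)
  have h1 := pt_sub_ne_zero hw t
  have h2 := pt_sub_ne_zero (ha p) t
  simp only [blaschke_eq_sub_mul_quot a p]
  field_simp
  ring

/-- The conjugate of the integrand is z times a Hardy function. -/
theorem integral_pt_div_mul_inv {w v : ℂ} (hw : ‖w‖ < 1) (hv : ‖v‖ < 1) :
    ∫ t, pt t / (pt t - w) * (pt t - v)⁻¹ ∂haarAddCircle = 0 := by
  have h := congrArg conj ((isHardy_szego hv).div_one_sub hw).integral_pt_mul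
  rw [map_zero, ← integral_conj] at h
  rw [← h]
  refine integral_congr_ae (.of_forall fun t => ?_)
  have h1 := pt_sub_ne_zero hv t
  have h2 := pt_ne_zero t
  simp only [map_mul, conj_szego hv, conj_szego hw, conj_pt]
  field_simp

/-- On the circle c/(z - v) is antianalytic with mean 0, so the Cauchy integral kills it and only G
remains. -/
theorem cauchy_inv_sub_mul_eval {w v : ℂ} (hw : ‖w‖ < 1) (hv : ‖v‖ < 1) {F G : Polynomial ℂ}
    {c : ℂ} (h : F = .C c + (.X - .C v) * G) :
    cauchy w (fun t => (pt t - v)⁻¹ * F.eval (pt t)) = G.eval w := by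
  have h1 := integral_pt_div_mul_inv hw hv
  have h2 := integral_cauchy (F := fun z => G.eval z) G.differentiable.differentiableOn hw
  rw [← h2, cauchy]
  have h3 : ∀ t : UnitAddCircle, pt t / (pt t - w) * ((pt t - v)⁻¹ * F.eval (pt t)) =
      pt t / (pt t - w) * (pt t - v)⁻¹ * c + pt t / (pt t - w) * G.eval (pt t) := by
    intro t
    have h4 := pt_sub_ne_zero hv t
    have h5 := pt_sub_ne_zero hw t
    simp only [h, Polynomial.eval_add, Polynomial.eval_mul, Polynomial.eval_sub,
      Polynomial.eval_C, Polynomial.eval_X]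
    field_simp
  simp only [h3]
  rw [integral_add, integral_mul_const, h1, zero_mul, zero_add]
  · exact (integrable_cauchy hw (memLp_comp_pt (continuousOn_inv_sub hv))).mul_const c
  · exact integrable_cauchy hw
      (memLp_comp_pt (g := fun z => G.eval z) G.continuous.continuousOn)

theorem exists_hermite_interpolation (S : Finset ℂ) (u d : ℂ → ℂ) :
    ∃ F : Polynomial ℂ, ∀ x ∈ S, F.eval x = u x ∧ F.derivative.eval x = d x := by
  set P := Lagrange.interpolate S id u
  set N := Lagrange.nodal S (id : ℂ → ℂ)
  set Q := Lagrange.interpolate S id fun x => (d x - P.derivative.eval x) / N.derivative.eval x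
  -- N vanishes at the nodes, so N Q keeps the values of P and adds N'Q to its derivative there.
  refine ⟨P + N * Q, fun x hx => ?_⟩
  have hinj : Set.InjOn (id : ℂ → ℂ) S := Function.injective_id.injOn
  have h1 : P.eval x = u x := Lagrange.eval_interpolate_at_node u hinj hx
  have h2 : N.eval x = 0 := Lagrange.eval_nodal_at_node (v := id) hx
  have h3 : Q.eval x = _ := Lagrange.eval_interpolate_at_node _ hinj hx
  have h4 : N.derivative.eval x ≠ 0 := by
    have h5 := Lagrange.nodalWeight_ne_zero hinj hx
    rw [Lagrange.nodalWeight_eq_eval_derivative_nodal hx] at h5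
    exact fun h6 => h5 (inv_eq_zero.2 h6)
  refine ⟨by simp [h1, h2], ?_⟩
  simp only [Polynomial.derivative_add, Polynomial.derivative_mul, Polynomial.eval_add,
    Polynomial.eval_mul, h2, h3, zero_mul, add_zero]
  field_simp
  ring

theorem memLp_quot_mul {m : ℕ} {a : Fin m → ℂ} (ha : ∀ i, ‖a i‖ < 1) (p : Fin m)
    (φ : L2) :
    MemLp (fun t => quot a p (pt t) * φ t) 2 (haarAddCircle : Measure UnitAddCircle) :=
  memLp_mul_comp_pt ((differentiableOn_quot ha p).continuousOn.mono sphere_subset_closedBall)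
    (Lp.memLp φ)

/-! ### Matrices of truncated Toeplitz operators. -/

section Operators

variable {m n : ℕ} [NeZero m] [NeZero n] {a : Fin m → ℂ} {b : Fin n → ℂ}

theorem ae_eq_sum_quot (ha : ∀ i, ‖a i‖ < 1) (ha_inj : Function.Injective a)
    (f : modelSpace (blaschke a)) :
    ∀ᵐ t ∂haarAddCircle,
      (f : L2) t = ∑ p, (conjKernelBasis ha ha_inj).repr f p * quot a p (pt t) := by
  have h : (f : L2) = ∑ p, (conjKernelBasis ha ha_inj).repr f p • (quotL2 ha p : L2) := by
    conv_lhs => rw [← (conjKernelBasis ha ha_inj).sum_repr f]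
    simp [conjKernelBasis_apply]
  have h1 := Lp.coeFn_finsetSum (μ := (haarAddCircle : Measure UnitAddCircle)) Finset.univ
    fun p => (conjKernelBasis ha ha_inj).repr f p • (quotL2 ha p : L2)
  have h2 : ∀ᵐ t ∂(haarAddCircle : Measure UnitAddCircle), ∀ p,
      ((conjKernelBasis ha ha_inj).repr f p • (quotL2 ha p : L2)) t =
        (conjKernelBasis ha ha_inj).repr f p * quot a p (pt t) := by
    refine ae_all_iff.2 fun p => ?_
    filter_upwards [Lp.coeFn_smul ((conjKernelBasis ha ha_inj).repr f p) (quotL2 ha p : L2),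
      coeFn_quotL2 ha p] with t h3 h4
    rw [h3, Pi.smul_apply, h4, smul_eq_mul]
  filter_upwards [h1, h2] with t h3 h4
  rw [h, h3, Finset.sum_apply]
  exact Finset.sum_congr rfl fun p _ => h4 p

theorem isATTO_iff_exists_symbol (ha : ∀ i, ‖a i‖ < 1) (hb : ∀ j, ‖b j‖ < 1)
    (ha_inj : Function.Injective a) (hb_inj : Function.Injective b)
    (A : modelSpace (blaschke a) →ₗ[ℂ] modelSpace (blaschke b)) :
    IsATTO (blaschke a) (blaschke b) A ↔ ∃ φ : L2, ∀ s p,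
      quot b s (b s) *
          LinearMap.toMatrix (conjKernelBasis ha ha_inj) (conjKernelBasis hb hb_inj) A s p =
        cauchy (b s) fun t => quot a p (pt t) * φ t := by
  constructor
  · rintro ⟨-, φ, hφ⟩
    refine ⟨φ, fun s p => ?_⟩
    have h1 : ∀ᵐ t ∂haarAddCircle, quot a p (pt t) * φ t = φ t * (quotL2 ha p : L2) t := by
      filter_upwards [coeFn_quotL2 ha p] with t ht
      rw [ht, mul_comm]
    have hf := (memLp_quot_mul ha p φ).ae_eq h1
    rw [LinearMap.toMatrix_apply, conjKernelBasis_repr, conjKernelBasis_apply,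
      hφ (quotL2 ha p) hf, cauchy_starProjection hb, cauchy_congr hf.coeFn_toLp, cauchy_congr h1]
  · rintro ⟨φ, hφ⟩
    have : Module.Finite ℂ (modelSpace (blaschke a)) := .of_basis (conjKernelBasis ha ha_inj)
    refine ⟨A.continuous_of_finiteDimensional, φ, fun f hf => ?_⟩
    suffices h : A f = ⟨_, Submodule.starProjection_apply_mem (modelSpace (blaschke b))
        (hf.toLp _)⟩ from congrArg Subtype.val h
    -- Elements of the target space are determined by their values at the zeros of β.
    refine evalZeros_injective hb hb_inj (funext fun s => ?_)
    rw [evalZeros_apply, evalZeros_apply, cauchy_starProjection hb, cauchy_congr hf.coeFn_toLp,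
      ← conjKernelBasis_repr hb hb_inj,
      ← LinearMap.toMatrix_mulVec_repr (conjKernelBasis ha ha_inj), Matrix.mulVec, dotProduct,
      Finset.mul_sum]
    have h1 : ∀ᵐ t ∂haarAddCircle, φ t * (f : L2) t =
        ∑ p, (conjKernelBasis ha ha_inj).repr f p * (quot a p (pt t) * φ t) := by
      filter_upwards [ae_eq_sum_quot ha ha_inj f] with t ht
      rw [ht, Finset.mul_sum]
      exact Finset.sum_congr rfl fun p _ => by ring
    rw [cauchy_congr h1, cauchy_sum_mul _ (hb s) _ fun p => memLp_quot_mul ha p φ]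
    refine Finset.sum_congr rfl fun p _ => ?_
    rw [← hφ]
    ring

/-- The matrices of the truncated Toeplitz operators are those which, after multiplication of the
entries by `β'(b s) (a p - b s)`, are differences of a function on the zeros of `α` and a
function on the zeros of `β` that agree on the common zeros. -/
theorem isATTO_iff_exists_sub (ha : ∀ i, ‖a i‖ < 1) (hb : ∀ j, ‖b j‖ < 1)
    (ha_inj : Function.Injective a) (hb_inj : Function.Injective b)
    (A : modelSpace (blaschke a) →ₗ[ℂ] modelSpace (blaschke b)) :
    IsATTO (blaschke a) (blaschke b) A ↔ ∃ (U : Fin m → ℂ) (V : Fin n → ℂ),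
      (∀ p s, a p = b s → U p = V s) ∧ ∀ s p,
      (a p - b s) * (quot b s (b s) *
        LinearMap.toMatrix (conjKernelBasis ha ha_inj) (conjKernelBasis hb hb_inj) A s p) =
          U p - V s := by
  rw [isATTO_iff_exists_symbol ha hb ha_inj hb_inj]
  generalize LinearMap.toMatrix (conjKernelBasis ha ha_inj) (conjKernelBasis hb hb_inj) A = M
  constructor
  · rintro ⟨φ, hφ⟩
    refine ⟨fun p => cauchy (a p) fun t => blaschke a (pt t) * φ t,
      fun s => cauchy (b s) fun t => blaschke a (pt t) * φ t, fun p s h => by simp only [h],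
      fun s p => ?_⟩
    rw [hφ, cauchy_quot_eq_sub ha (hb s)]
  · rintro ⟨U, V, hUV, hM⟩
    -- The derivative matters only at common zeros, where it must equal the unconstrained entry;
    -- elsewhere it is set to 0.
    obtain ⟨F, hF⟩ := exists_hermite_interpolation (Finset.univ.image a ∪ Finset.univ.image b)
      (Function.extend a U (Function.extend b V 0))
      (Function.extend a
        (fun p => Function.extend b (fun s => quot b s (b s) * M s p) 0 (a p)) 0)
    have hFa : ∀ p, F.eval (a p) = U p := fun p => by
      rw [(hF (a p) (by simp)).1, ha_inj.extend_apply]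
    have hFb : ∀ s, F.eval (b s) = V s := fun s => by
      by_cases h : ∃ p, a p = b s
      · obtain ⟨p, hp⟩ := h
        rw [← hp, hFa, hUV p s hp]
      · rw [(hF (b s) (by simp)).1, Function.extend_apply' _ _ _ h, hb_inj.extend_apply]
    have hFd : ∀ s p, a p = b s → F.derivative.eval (a p) = quot b s (b s) * M s p :=
      fun s p h => by
        rw [(hF (a p) (by simp)).2, ha_inj.extend_apply, h, hb_inj.extend_apply]
    have hφ : MemLp (fun t => conj (blaschke a (pt t)) * F.eval (pt t)) 2
        (haarAddCircle : Measure UnitAddCircle) := by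
      refine memLp_mul_comp_pt (g := fun z => conj (blaschke a z))
        (Complex.continuous_conj.comp_continuousOn ?_)
        (memLp_comp_pt (g := fun z => F.eval z) F.continuous.continuousOn)
      rw [funext (blaschke_eq_sub_mul_quot a 0)]
      exact (by fun_prop : ContinuousOn _ _).mul
        ((differentiableOn_quot ha 0).continuousOn.mono sphere_subset_closedBall)
    refine ⟨hφ.toLp _, fun s p => ?_⟩
    obtain ⟨G, hG⟩ := Polynomial.X_sub_C_dvd_sub_C_eval (a := a p) (p := F)
    rw [sub_eq_iff_eq_add'] at hG
    have h1 : ∀ᵐ t ∂haarAddCircle, quot a p (pt t) * hφ.toLp _ t =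
        (pt t - a p)⁻¹ * F.eval (pt t) := by
      filter_upwards [hφ.coeFn_toLp] with t ht
      have h2 := conj_blaschke_mul_blaschke ha t
      have h3 : quot a p (pt t) = (pt t - a p)⁻¹ * blaschke a (pt t) := by
        rw [blaschke_eq_sub_mul_quot a p, inv_mul_cancel_left₀ (pt_sub_ne_zero (ha p) t)]
      rw [ht, h3]
      linear_combination (pt t - a p)⁻¹ * F.eval (pt t) * h2
    rw [cauchy_congr h1, cauchy_inv_sub_mul_eval (hb s) (ha p) hG]
    by_cases h : a p = b s
    -- At a common zero the difference quotient G takes the value F'(a p).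
    · rw [← hFd s p h, hG]
      simp [h]
    · refine mul_left_cancel₀ (sub_ne_zero.2 h) ?_
      rw [hM, ← hFa, ← hFb]
      conv_lhs => rw [hG]
      simp only [Polynomial.eval_add, Polynomial.eval_C, Polynomial.eval_mul, Polynomial.eval_sub,
        Polynomial.eval_X]
      ring

end Operators

/-! ### Elimination of U and V. -/

theorem exists_sub_iff_of_ne {m n : ℕ} [NeZero m] [NeZero n] {a : Fin m → ℂ} {b q : Fin n → ℂ}
    (hq : ∀ s, q s ≠ 0) (h : ∀ p s, a p ≠ b s) (t : Matrix (Fin n) (Fin m) ℂ) :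
    (∃ (U : Fin m → ℂ) (V : Fin n → ℂ), (∀ p s, a p = b s → U p = V s) ∧
      ∀ s p, (a p - b s) * (q s * t s p) = U p - V s) ↔
    ∀ s p, t s p = (q s * (a 0 - b s) * t s 0 + q 0 * (b 0 - a 0) * t 0 0
      + q 0 * (a p - b 0) * t 0 p) / (q s * (a p - b s)) := by
  have hd : ∀ s p, q s * (a p - b s) ≠ 0 := fun s p => mul_ne_zero (hq s) (sub_ne_zero.2 (h p s))
  simp only [eq_div_iff (hd _ _)]
  constructor
  · rintro ⟨U, V, -, hM⟩ s p
    linear_combination hM s p - hM s 0 + hM 0 0 - hM 0 p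
  · intro ht
    -- Normalized by V 0 = 0: row 0 gives U, then column 0 gives V.
    refine ⟨fun p => (a p - b 0) * (q 0 * t 0 p),
      fun s => (a 0 - b 0) * (q 0 * t 0 0) - (a 0 - b s) * (q s * t s 0),
      fun p s hps => absurd hps (h p s), fun s p => ?_⟩
    linear_combination ht s p

theorem exists_sub_iff_of_common {m n l : ℕ} [NeZero m] [NeZero n] {a : Fin m → ℂ}
    {b q : Fin n → ℂ} (hq : ∀ s, q s ≠ 0) (hl : 0 < l) (hlm : l ≤ m)
    (hab : ∀ (i : Fin m) (j : Fin n), a i = b j ↔ (i : ℕ) = (j : ℕ) ∧ (i : ℕ) < l)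
    (t : Matrix (Fin n) (Fin m) ℂ) :
    (∃ (U : Fin m → ℂ) (V : Fin n → ℂ), (∀ p s, a p = b s → U p = V s) ∧
      ∀ s p, (a p - b s) * (q s * t s p) = U p - V s) ↔
    (∀ (s : Fin n) (p : Fin m) (hs : (s : ℕ) < l), (s : ℕ) ≠ (p : ℕ) →
      t s p = (q 0 * (a 0 - b s) * t 0 ⟨s, hs.trans_le hlm⟩
        + q 0 * (a p - b 0) * t 0 p) / (q s * (a p - b s))) ∧
    (∀ (s : Fin n) (p : Fin m), l ≤ (s : ℕ) →
      t s p = (q s * (a 0 - b s) * t s 0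
        + q 0 * (a p - b 0) * t 0 p) / (q s * (a p - b s))) := by
  have h0 : a 0 = b 0 := (hab 0 0).2 (by simpa using hl)
  have hs' : ∀ (s : Fin n) (hs : (s : ℕ) < l), a ⟨s, hs.trans_le hlm⟩ = b s := fun s hs =>
    (hab _ _).2 ⟨rfl, hs⟩
  have hd : ∀ (s : Fin n) (p : Fin m), ¬((p : ℕ) = s ∧ (p : ℕ) < l) → q s * (a p - b s) ≠ 0 :=
    fun s p h => mul_ne_zero (hq s) (sub_ne_zero.2 (mt (hab p s).1 h))
  constructor
  · rintro ⟨U, V, hUV, hM⟩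
    have hU0 := hUV 0 0 h0
    constructor
    · intro s p hs hsp
      rw [eq_div_iff (hd s p fun h => hsp h.1.symm)]
      have h2 := hM 0 ⟨s, hs.trans_le hlm⟩
      rw [hs' s hs] at h2
      linear_combination hM s p - hM 0 p + h2 + hUV _ _ (hs' s hs) -
        q 0 * t 0 ⟨s, hs.trans_le hlm⟩ * h0
    · intro s p hs
      rw [eq_div_iff (hd s p fun h => by omega)]
      linear_combination hM s p - hM 0 p - hM s 0 - hU0
  · rintro ⟨h1, h2⟩
    -- Again V 0 = 0, and now U 0 = 0. For s < l, V s must equal U s, which row 0 supplies; column 0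
    -- supplies the other V s.
    refine ⟨fun p => (a p - b 0) * (q 0 * t 0 p),
      fun s => if hs : (s : ℕ) < l then (b s - b 0) * (q 0 * t 0 ⟨s, hs.trans_le hlm⟩)
        else -((a 0 - b s) * (q s * t s 0)), fun p s h => ?_, fun s p => ?_⟩
    · obtain ⟨hps, hp⟩ := (hab p s).1 h
      have hs : (s : ℕ) < l := hps ▸ hp
      have hp' : (⟨s, hs.trans_le hlm⟩ : Fin m) = p := Fin.ext hps.symm
      simp only [dif_pos hs, hp', h]
    · by_cases hs : (s : ℕ) < l
      · simp only [dif_pos hs]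
        -- For s = p both sides vanish, so this entry is unconstrained.
        by_cases hsp : (s : ℕ) = p
        · have hp' : (⟨s, hs.trans_le hlm⟩ : Fin m) = p := Fin.ext hsp
          have h3 := hs' s hs
          rw [hp'] at h3 ⊢
          rw [h3]
          ring
        · have h3 := h1 s p hs hsp
          rw [eq_div_iff (hd s p fun h => hsp h.1.symm)] at h3
          linear_combination h3 + q 0 * t 0 ⟨s, hs.trans_le hlm⟩ * h0
      · simp only [dif_neg hs]
        have h3 := h2 s p (not_lt.1 hs)
        rw [eq_div_iff (hd s p fun h => by omega)] at h3
        linear_combination h3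

end ATTO

end

/-- Indices start at `0`: the first zeros are `a 0` and `b 0`, and the first `l` zeros are those with
index `i < l`. -/
theorem theorem3p3 {m n : ℕ} [NeZero m] [NeZero n] (a : Fin m → ℂ) (b : Fin n → ℂ)
    (ha : ∀ i, ‖a i‖ < 1) (hb : ∀ j, ‖b j‖ < 1)
    (ha_inj : Function.Injective a) (hb_inj : Function.Injective b)
    (l : ℕ) (hlm : l ≤ m) (hln : l ≤ n)
    -- the common zeros are precisely the `a i = b i` with `i < l`
    (hab : ∀ (i : Fin m) (j : Fin n), a i = b j ↔ (i : ℕ) = (j : ℕ) ∧ (i : ℕ) < l) :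
    -- the conjugate kernels are bases of the two model spaces, and
    ∃ (e : Module.Basis (Fin m) ℂ (ATTO.modelSpace (ATTO.blaschke a)))
      (f : Module.Basis (Fin n) ℂ (ATTO.modelSpace (ATTO.blaschke b))),
      (∀ p, ∀ᵐ x ∂AddCircle.haarAddCircle,
        (e p : ATTO.L2) x = ATTO.conjKernel (ATTO.blaschke a) (a p) (ATTO.pt x)) ∧
      (∀ s, ∀ᵐ x ∂AddCircle.haarAddCircle,
        (f s : ATTO.L2) x = ATTO.conjKernel (ATTO.blaschke b) (b s) (ATTO.pt x)) ∧
      -- for every linear map `A`, with matrix `t` and `β' = deriv (ATTO.blaschke b)`: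
      ∀ (A : ATTO.modelSpace (ATTO.blaschke a) →ₗ[ℂ] ATTO.modelSpace (ATTO.blaschke b))
        (t : Matrix (Fin n) (Fin m) ℂ) (β' : ℂ → ℂ),
        t = LinearMap.toMatrix e f A → β' = deriv (ATTO.blaschke b) →
        (l = 0 →
          (ATTO.IsATTO (ATTO.blaschke a) (ATTO.blaschke b) A ↔
            ∀ (s : Fin n) (p : Fin m),
              t s p = (β' (b s) * (a 0 - b s) * t s 0 + β' (b 0) * (b 0 - a 0) * t 0 0
                + β' (b 0) * (a p - b 0) * t 0 p) / (β' (b s) * (a p - b s)))) ∧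
        (0 < l →
          (ATTO.IsATTO (ATTO.blaschke a) (ATTO.blaschke b) A ↔
            (∀ (s : Fin n) (p : Fin m) (hs : (s : ℕ) < l), (s : ℕ) ≠ (p : ℕ) →
              t s p = (β' (b 0) * (a 0 - b s) * t 0 ⟨s, hs.trans_le hlm⟩
                + β' (b 0) * (a p - b 0) * t 0 p) / (β' (b s) * (a p - b s))) ∧
            (∀ (s : Fin n) (p : Fin m), l ≤ (s : ℕ) →
              t s p = (β' (b s) * (a 0 - b s) * t s 0
                + β' (b 0) * (a p - b 0) * t 0 p) / (β' (b s) * (a p - b s))))) := by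
  refine ⟨ATTO.conjKernelBasis ha ha_inj, ATTO.conjKernelBasis hb hb_inj, fun p => ?_, fun s => ?_,
    ?_⟩
  · filter_upwards [ATTO.coeFn_quotL2 ha p] with x hx
    rw [ATTO.conjKernelBasis_apply, hx, ATTO.conjKernel_blaschke ha]
  · filter_upwards [ATTO.coeFn_quotL2 hb s] with x hx
    rw [ATTO.conjKernelBasis_apply, hx, ATTO.conjKernel_blaschke hb]
  · rintro A t β' rfl rfl
    simp only [ATTO.deriv_blaschke hb, ATTO.isATTO_iff_exists_sub ha hb ha_inj hb_inj]
    have hq := ATTO.quot_self_ne_zero hb hb_inj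
    refine ⟨fun hl => ?_, fun hl => ?_⟩
    · exact ATTO.exists_sub_iff_of_ne (q := fun s => ATTO.quot b s (b s)) hq
        (fun p s h => by have := ((hab p s).1 h).2; omega) _
    · exact ATTO.exists_sub_iff_of_common (q := fun s => ATTO.quot b s (b s)) hq hl hlm hab _
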